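/- Formulas are the modal formulas built from countably many propositional variables with $\bot,\to,\Box$. A normal modal logic is a set of formulas containing all classical propositional tautologies and $\Box(p\to q)\to(\Box p\to\Box q)$, closed under modus ponens, necessitation and uniform substitution. Let $\mathsf{K}$ be the least normal modal logic and $\mathrm{NExt}\,\mathsf{K}$ the complete lattice of all normal modal logics ordered by inclusion; for a formula $\varphi$ let $\mathsf{K}+\varphi$ be the least normal modal logic containing $\varphi$. A splitting pair of a complete lattice $X$ is a pair $(x,y)$ of elements with $x\not\le y$ such that every $z\in X$ satisfies $x\le z$ or $z\le y$; an element $x\in X$ is called a splitting in $X$ if $(x,y)$ is a splitting pair for some $y\in X$. Theorem. Being a splitting is decidable in $\mathrm{NExt}\,\mathsf{K}$. That is, the set of (Gödel numbers of) formulas $\varphi$ such that $\mathsf{K}+\varphi$ is a splitting in $\mathrm{NExt}\,\mathsf{K}$ is decidable (recursive). -/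

import Mathlib

/-- Formulas of the basic modal language, over countably many propositional variables.
The remaining connectives are the usual abbreviations. -/
inductive Formula : Type
  | var : ℕ → Formula
  | bot : Formula
  | imp : Formula → Formula → Formula
  | box : Formula → Formula

namespace Formula

/-- Negation. -/
def neg (φ : Formula) : Formula := imp φ bot

/-- The formula obtained by simultaneously substituting `σ n` for the `n`-th variable. -/
def subst (σ : ℕ → Formula) : Formula → Formula
  | var n => σ n
  | bot => bot
  | imp φ ψ => imp (φ.subst σ) (ψ.subst σ)
  | box φ => box (φ.subst σ)

/-- The Gödel number of a formula. -/
def code : Formula → ℕ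
  | bot => 0
  | var n => 3 * n + 1
  | imp φ ψ => 3 * Nat.pair φ.code ψ.code + 2
  | box φ => 3 * φ.code + 3

theorem code_injective : Function.Injective code := by
  intro φ
  induction φ with
  | bot => intro ψ h; cases ψ <;> simp only [code] at h <;> first | rfl | omega
  | var n =>
    intro ψ h
    cases ψ <;> simp only [code] at h <;> first | omega | skip
    congr 1
    omega
  | imp a b iha ihb =>
    intro ψ h
    cases ψ with
    | imp c d =>
      simp only [code] at h
      have h' : Nat.pair a.code b.code = Nat.pair c.code d.code := by omega
      rw [Nat.pair_eq_pair] at h'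
      rw [iha h'.1, ihb h'.2]
    | _ => simp only [code] at h; omega
  | box a iha =>
    intro ψ h
    cases ψ with
    | box c =>
      simp only [code] at h
      rw [iha (show a.code = c.code by omega)]
    | _ => simp only [code] at h; omega

theorem code_surjective : Function.Surjective code := by
  intro n
  induction n using Nat.strong_induction_on with
  | _ n ih =>
    obtain h | h | h | h : n = 0 ∨ n = 3 * ((n - 1) / 3) + 1 ∨ n = 3 * ((n - 1) / 3) + 2 ∨
        n = 3 * ((n - 1) / 3) + 3 := by omega
    · exact ⟨bot, h.symm⟩
    · exact ⟨var ((n - 1) / 3), h.symm⟩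
    · have h1 := Nat.unpair_left_le ((n - 1) / 3)
      have h2 := Nat.unpair_right_le ((n - 1) / 3)
      obtain ⟨a, ha⟩ := ih _ (show (Nat.unpair ((n - 1) / 3)).1 < n by omega)
      obtain ⟨b, hb⟩ := ih _ (show (Nat.unpair ((n - 1) / 3)).2 < n by omega)
      refine ⟨imp a b, ?_⟩
      simp only [code, ha, hb, Nat.pair_unpair]
      exact h.symm
    · obtain ⟨a, ha⟩ := ih _ (show (n - 1) / 3 < n by omega)
      refine ⟨box a, ?_⟩
      simp only [code, ha]
      exact h.symm

/-- The Gödel numbering is a bijection between formulas and natural numbers. -/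
noncomputable def codeEquiv : Formula ≃ ℕ :=
  Equiv.ofBijective code ⟨code_injective, code_surjective⟩

/-- Computability over formulas is computability over their Gödel numbers. -/
noncomputable instance : Primcodable Formula := Primcodable.ofEquiv ℕ codeEquiv

end Formula

/-- A normal modal logic: a set of formulas that contains classical propositional logic (given by
the Hilbert axiom schemes `taut_k`, `taut_s`, `taut_dne`, which are complete for the connectives
`→` and `⊥`) and the axiom `□(φ → ψ) → (□φ → □ψ)`, and is closed under modus ponens,
necessitation and uniform substitution. -/
structure NormalLogic where
  carrier : Set Formula
  taut_k : ∀ φ ψ : Formula, φ.imp (ψ.imp φ) ∈ carrier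
  taut_s : ∀ φ ψ χ : Formula,
    (φ.imp (ψ.imp χ)).imp ((φ.imp ψ).imp (φ.imp χ)) ∈ carrier
  taut_dne : ∀ φ : Formula, φ.neg.neg.imp φ ∈ carrier
  axiom_k : ∀ φ ψ : Formula, (φ.imp ψ).box.imp (φ.box.imp ψ.box) ∈ carrier
  mp : ∀ φ ψ : Formula, φ.imp ψ ∈ carrier → φ ∈ carrier → ψ ∈ carrier
  nec : ∀ φ : Formula, φ ∈ carrier → φ.box ∈ carrier
  subst_mem : ∀ (σ : ℕ → Formula) (φ : Formula), φ ∈ carrier → φ.subst σ ∈ carrier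

namespace NormalLogic

theorem carrier_injective : Function.Injective carrier := by
  intro L M h
  cases L
  cases M
  cases h
  rfl

/-- Logics are ordered by inclusion. -/
instance : PartialOrder NormalLogic := PartialOrder.lift carrier carrier_injective

/-- The infimum of a set of logics is their intersection. -/
instance : InfSet NormalLogic where
  sInf S :=
    { carrier := {φ | ∀ L ∈ S, φ ∈ L.carrier}
      taut_k := fun φ ψ L _ => L.taut_k φ ψ
      taut_s := fun φ ψ χ L _ => L.taut_s φ ψ χ
      taut_dne := fun φ L _ => L.taut_dne φ
      axiom_k := fun φ ψ L _ => L.axiom_k φ ψ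
      mp := fun φ ψ h h' L hL => L.mp φ ψ (h L hL) (h' L hL)
      nec := fun φ h L hL => L.nec φ (h L hL)
      subst_mem := fun σ φ h L hL => L.subst_mem σ φ (h L hL) }

theorem isGLB_sInf' (S : Set NormalLogic) : IsGLB S (sInf S) :=
  ⟨fun L hL _ hφ => hφ L hL, fun _ hM _ hφ _ hL => hM hL hφ⟩

/-- The complete lattice of all normal modal logics. -/
instance : CompleteLattice NormalLogic := completeLatticeOfInf NormalLogic isGLB_sInf'

/-- The logic `K`, the least normal modal logic. -/
def K : NormalLogic := ⊥

/-- The lattice `NExt L₀` of all normal modal logics containing `L₀`, ordered by inclusion. -/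
abbrev NExt (L₀ : NormalLogic) : Type := Set.Ici L₀

/-- The logic `L₀ + φ`: the least normal modal logic containing `L₀` and the formula `φ`. -/
def add (L₀ : NormalLogic) (φ : Formula) : NExt L₀ :=
  ⟨sInf {L | L₀ ≤ L ∧ φ ∈ L.carrier}, Set.mem_Ici.mpr (le_sInf fun _ hL => hL.1)⟩

/-- A property `P` of logics is decidable in `NExt L₀` if the set of formulas `φ` such that
`L₀ + φ` has `P` is decidable. -/
def DecidableIn (L₀ : NormalLogic) (P : NExt L₀ → Prop) : Prop :=
  ComputablePred fun φ : Formula => P (add L₀ φ)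

end NormalLogic

/-- `(x, y)` is a splitting pair: `x ≰ y`, and every `z` satisfies `x ≤ z` or `z ≤ y`. -/
def IsSplittingPair {X : Type*} [PartialOrder X] (x y : X) : Prop :=
  ¬ x ≤ y ∧ ∀ z : X, x ≤ z ∨ z ≤ y

/-- `x` is a splitting in `X`: it is the first component `x` of a splitting pair `(x, y)`, that is,
some `y` splits `X` and `x` is the least element not below `y`. -/
def IsSplitting {X : Type*} [PartialOrder X] (x : X) : Prop :=
  ∃ y : X, IsSplittingPair x y

/-! Splitting pairs of `NExt K` come from finite acyclic frames. Let (K + φ, y) be a splitting pair.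
A model of y refutes φ, and so does its product with a countdown longer than the modal depth of φ.
The logic of that product misses φ, hence lies below y, so y bounds the length of chains
(`exists_heightLE_of_isSplittingPair`). On points of bounded height the map to k-bisimulation types,
for large k, is a p-morphism. Filtrating through it yields a finite acyclic frame F that refutes φ
and validates y, of size bounded computably in φ. Every finite frame G refuting φ then satisfies Log
G ≤ y ≤ Log F, and a Jankov–Fine argument (`exists_isFunBisim`) shows that each point of F generates
a p-morphic image of a generated subframe of G.

Conversely, suppose some such F has this property for all G up to a computable size. If z misses φ,
filtrate a model of z through types deeper than F is high. The resulting G refutes φ and so maps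
onto each point-generated subframe of F. The map lifts to the model because points sent into F have
bounded height and types determine such points. As types are definable by formulas, closure of z
under substitution gives z ≤ Log F (`sat_of_isFunBisim_typeCode`). So K + φ is a splitting iff a
statement with only bounded quantifiers holds, and that statement is primitive recursive in the code
of φ. -/

namespace Formula

/-- Truth of a formula at a point of a Kripke model. -/
def Sat {W : Type} (R : W → W → Prop) (V : ℕ → W → Prop) : Formula → W → Prop
  | var n, x => V n x
  | bot, _ => False
  | imp φ ψ, x => Sat R V φ x → Sat R V ψ x
  | box φ, x => ∀ y, R x y → Sat R V φ y

theorem sat_subst {W : Type} (R : W → W → Prop) (V : ℕ → W → Prop) (σ : ℕ → Formula)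
    (φ : Formula) (x : W) :
    (φ.subst σ).Sat R V x ↔ φ.Sat R (fun n y => (σ n).Sat R V y) x := by
  induction φ generalizing x with
  | var n => rfl
  | bot => rfl
  | imp a b iha ihb => simp only [subst, Sat, iha, ihb]
  | box a iha => simp only [subst, Sat, iha]

end Formula

/-! ### Logics of frames and the canonical model -/

namespace NormalLogic

open Formula

/-- The logic of a Kripke frame, restricted to a set `D` of points closed under successors. -/
def frameLogic {W : Type} (R : W → W → Prop) (D : Set W) (hD : ∀ x ∈ D, ∀ y, R x y → y ∈ D) :
    NormalLogic where
  carrier := {φ | ∀ V : ℕ → W → Prop, ∀ x ∈ D, φ.Sat R V x}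
  taut_k _ _ _ _ _ h _ := h
  taut_s _ _ _ _ _ _ h h' h'' := h h'' (h' h'')
  taut_dne _ _ _ _ h := not_not.mp h
  axiom_k _ _ _ _ _ h h' y hy := h y hy (h' y hy)
  mp _ _ h h' V x hx := h V x hx (h' V x hx)
  nec _ h V x hx y hy := h V y (hD x hx y hy)
  subst_mem σ φ h V x hx := (sat_subst R V σ φ x).mpr (h _ x hx)

/-- A set of formulas containing the logic and closed under modus ponens. -/
structure IsTheory (L : NormalLogic) (Γ : Set Formula) : Prop where
  subset : L.carrier ⊆ Γ
  mp : ∀ {a b : Formula}, a.imp b ∈ Γ → a ∈ Γ → b ∈ Γ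

/-- A complete consistent theory: a point of the canonical model. -/
structure IsPoint (L : NormalLogic) (Γ : Set Formula) : Prop where
  subset : L.carrier ⊆ Γ
  bot_notMem : bot ∉ Γ
  imp_mem : ∀ a b : Formula, a.imp b ∈ Γ ↔ (a ∈ Γ → b ∈ Γ)

namespace IsTheory

variable {L : NormalLogic} {Γ : Set Formula}

theorem imp_of_mem (h : L.IsTheory Γ) {a b : Formula} (hb : b ∈ Γ) : a.imp b ∈ Γ :=
  h.mp (h.subset (L.taut_k b a)) hb

theorem imp_mp (h : L.IsTheory Γ) {a b c : Formula} (h1 : a.imp (b.imp c) ∈ Γ)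
    (h2 : a.imp b ∈ Γ) : a.imp c ∈ Γ :=
  h.mp (h.mp (h.subset (L.taut_s a b c)) h1) h2

theorem imp_self (h : L.IsTheory Γ) (a : Formula) : a.imp a ∈ Γ :=
  h.imp_mp (h.subset (L.taut_k a (a.imp a))) (h.subset (L.taut_k a a))

theorem imp_trans (h : L.IsTheory Γ) {a b c : Formula} (h1 : a.imp b ∈ Γ)
    (h2 : b.imp c ∈ Γ) : a.imp c ∈ Γ :=
  h.imp_mp (h.imp_of_mem h2) h1

theorem efq (h : L.IsTheory Γ) (a : Formula) : bot.imp a ∈ Γ :=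
  h.imp_trans (h.subset (L.taut_k bot a.neg)) (h.subset (L.taut_dne a))

/-- The deduction theorem. -/
theorem adjoin (h : L.IsTheory Γ) (a : Formula) : L.IsTheory {b | a.imp b ∈ Γ} where
  subset _ hb := h.imp_of_mem (h.subset hb)
  mp h1 h2 := h.imp_mp h1 h2

theorem box_preimage (h : L.IsTheory Γ) : L.IsTheory {b | b.box ∈ Γ} where
  subset b hb := h.subset (L.nec b hb)
  mp h1 h2 := h.mp (h.mp (h.subset (L.axiom_k _ _)) h1) h2

/-- Lindenbaum's lemma. -/
theorem exists_point (h : L.IsTheory Γ) {φ : Formula} (hφ : φ ∉ Γ) :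
    ∃ Δ, L.IsPoint Δ ∧ Γ ⊆ Δ ∧ φ ∉ Δ := by
  -- Adding the negation of φ keeps Γ consistent; a maximal consistent theory above this one omits
  -- φ.
  have hΓ : L.IsTheory {b | φ.neg.imp b ∈ Γ} := h.adjoin _
  have hbot : bot ∉ {b | φ.neg.imp b ∈ Γ} := fun h' => hφ (h.mp (h.subset (L.taut_dne φ)) h')
  obtain ⟨Δ, hsub, hmax⟩ := zorn_subset_nonempty {Δ | L.IsTheory Δ ∧ bot ∉ Δ} (by
    intro C hC hchain hne
    refine ⟨⋃₀ C, ⟨⟨?_, ?_⟩, ?_⟩, fun s hs => Set.subset_sUnion_of_mem hs⟩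
    · obtain ⟨Δ, hΔ⟩ := hne
      exact (hC hΔ).1.subset.trans (Set.subset_sUnion_of_mem hΔ)
    · rintro a b ⟨s, hs, has⟩ ⟨t, ht, hat⟩
      obtain hst | hst := hchain.total hs ht
      · exact ⟨t, ht, (hC ht).1.mp (hst has) hat⟩
      · exact ⟨s, hs, (hC hs).1.mp has (hst hat)⟩
    · rintro ⟨s, hs, hb⟩
      exact (hC hs).2 hb) _ ⟨hΓ, hbot⟩
  have hΔ : L.IsTheory Δ := hmax.prop.1
  have hneg : ∀ a, a ∉ Δ → a.neg ∈ Δ := by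
    intro a ha
    by_contra hna
    exact ha (hmax.le_of_ge ⟨hΔ.adjoin a, hna⟩ (fun b hb => hΔ.imp_of_mem hb) (hΔ.imp_self a))
  refine ⟨Δ, ⟨hΔ.subset, hmax.prop.2, fun a b => ⟨hΔ.mp, fun hab => ?_⟩⟩,
    fun b hb => hsub (h.imp_of_mem hb), fun hφΔ => ?_⟩
  · by_cases ha : a ∈ Δ
    · exact hΔ.imp_of_mem (hab ha)
    · exact hΔ.imp_trans (hneg a ha) (hΔ.efq b)
  · exact hmax.prop.2 (hΔ.mp (hsub (h.imp_self φ.neg)) hφΔ)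

end IsTheory

theorem IsPoint.isTheory {L : NormalLogic} {Γ : Set Formula} (h : L.IsPoint Γ) : L.IsTheory Γ :=
  ⟨h.subset, fun h1 h2 => (h.imp_mem _ _).mp h1 h2⟩

theorem isTheory_carrier (L : NormalLogic) : L.IsTheory L.carrier :=
  ⟨subset_rfl, fun h1 h2 => L.mp _ _ h1 h2⟩

/-- Every normal logic is the set of formulas true in its canonical model. -/
theorem exists_model (L : NormalLogic) :
    ∃ (W : Type) (R : W → W → Prop) (V : ℕ → W → Prop),
      ∀ φ : Formula, φ ∈ L.carrier ↔ ∀ x, φ.Sat R V x := by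
  let W : Type := {Γ : Set Formula // L.IsPoint Γ}
  let R : W → W → Prop := fun Γ Δ => ∀ a : Formula, a.box ∈ Γ.1 → a ∈ Δ.1
  let V : ℕ → W → Prop := fun n Γ => var n ∈ Γ.1
  have truth : ∀ (φ : Formula) (Γ : W), φ.Sat R V Γ ↔ φ ∈ Γ.1 := by
    intro φ
    induction φ with
    | var n => intro Γ; rfl
    | bot => intro Γ; exact ⟨False.elim, Γ.2.bot_notMem⟩
    | imp a b iha ihb => intro Γ; rw [Γ.2.imp_mem, ← iha, ← ihb]; rfl
    | box a iha =>
      intro Γ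
      refine ⟨fun h => ?_, fun h Δ hΔ => (iha Δ).mpr (hΔ a h)⟩
      by_contra ha
      obtain ⟨Δ, hΔ, hsub, haΔ⟩ := Γ.2.isTheory.box_preimage.exists_point ha
      exact haΔ ((iha ⟨Δ, hΔ⟩).mp (h ⟨Δ, hΔ⟩ fun b hb => hsub hb))
  refine ⟨W, R, V, fun φ => ⟨fun h Γ => (truth φ Γ).mpr (Γ.2.subset h), fun h => ?_⟩⟩
  by_contra hφ
  obtain ⟨Δ, hΔ, -, hφΔ⟩ := L.isTheory_carrier.exists_point hφ
  exact hφΔ ((truth φ ⟨Δ, hΔ⟩).mp (h ⟨Δ, hΔ⟩))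

theorem mem_add (L : NormalLogic) (φ : Formula) : φ ∈ (add L φ).1.carrier :=
  fun _ hM => hM.2

theorem add_le_iff {L : NormalLogic} {φ : Formula} {M : NExt L} :
    add L φ ≤ M ↔ φ ∈ M.1.carrier :=
  ⟨fun h => h (mem_add L φ), fun h => sInf_le (a := M.1) ⟨M.2, h⟩⟩

end NormalLogic

/-! ### Finite sets as binary numerals -/

/-- The set of natural numbers coded by the binary digits of `n`. -/
def Bit (n i : ℕ) : Prop := n.testBit i = true

/-- The number whose binary digits below `m` code the set `P`. -/
noncomputable def encodeSet (m : ℕ) (P : ℕ → Prop) : ℕ :=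
  Nat.ofBits fun i : Fin m => @decide (P i) (Classical.propDecidable _)

theorem bit_encodeSet {m : ℕ} {P : ℕ → Prop} {i : ℕ} : Bit (encodeSet m P) i ↔ i < m ∧ P i := by
  unfold Bit encodeSet
  by_cases h : i < m
  · rw [Nat.testBit_ofBits_lt _ _ h]
    simp [h]
  · rw [Nat.testBit_ofBits_ge _ _ (not_lt.mp h)]
    simp [h]

theorem encodeSet_lt (m : ℕ) (P : ℕ → Prop) : encodeSet m P < 2 ^ m :=
  Nat.ofBits_lt_two_pow _

theorem Bit.lt {n i : ℕ} (h : Bit n i) : i < n :=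
  Nat.lt_two_pow_self.trans_le (Nat.ge_two_pow_of_testBit h)

theorem Bit.lt_of_lt_two_pow {n i m : ℕ} (h : Bit n i) (hn : n < 2 ^ m) : i < m := by
  by_contra hi
  exact absurd (Nat.ge_two_pow_of_testBit h)
    (not_le.mpr (hn.trans_le (Nat.pow_le_pow_right two_pos (not_lt.mp hi))))

theorem eq_of_bit_iff {a b : ℕ} (h : ∀ i, Bit a i ↔ Bit b i) : a = b :=
  Nat.eq_of_testBit_eq fun i => Bool.eq_iff_iff.mpr (h i)

theorem encodeSet_eq_iff {m : ℕ} {P : ℕ → Prop} {a : ℕ} :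
    encodeSet m P = a ↔ a < 2 ^ m ∧ ∀ i < m, (Bit a i ↔ P i) := by
  constructor
  · rintro rfl
    exact ⟨encodeSet_lt m P, fun i hi => by rw [bit_encodeSet, and_iff_right hi]⟩
  · rintro ⟨ha, h⟩
    refine eq_of_bit_iff fun i => ?_
    rw [bit_encodeSet]
    exact ⟨fun hi => (h i hi.1).mpr hi.2,
      fun hi => ⟨hi.lt_of_lt_two_pow ha, (h i (hi.lt_of_lt_two_pow ha)).mp hi⟩⟩

/-! ### Definable properties, bisimulation types and filtration -/

namespace Formula

/-- A property of points of Kripke models is expressible if it is defined by a formula. -/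
def Expressible (P : ∀ W : Type, (W → W → Prop) → (ℕ → W → Prop) → W → Prop) : Prop :=
  ∃ χ : Formula, ∀ W R V x, χ.Sat R V x ↔ P W R V x

namespace Expressible

variable {P Q : ∀ W : Type, (W → W → Prop) → (ℕ → W → Prop) → W → Prop}

theorem var (n : ℕ) : Expressible fun _ _ V x => V n x := ⟨.var n, fun _ _ _ _ => Iff.rfl⟩

theorem imp (hP : Expressible P) (hQ : Expressible Q) :
    Expressible fun W R V x => P W R V x → Q W R V x := by
  obtain ⟨a, ha⟩ := hP
  obtain ⟨b, hb⟩ := hQ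
  exact ⟨a.imp b, fun W R V x => imp_congr (ha W R V x) (hb W R V x)⟩

theorem box (hP : Expressible P) :
    Expressible fun W R V x => ∀ y, R x y → P W R V y := by
  obtain ⟨a, ha⟩ := hP
  exact ⟨a.box, fun W R V x => by simp only [← ha]; rfl⟩

theorem congr (hP : Expressible P) (h : ∀ W R V x, P W R V x ↔ Q W R V x) : Expressible Q := by
  obtain ⟨a, ha⟩ := hP
  exact ⟨a, fun W R V x => (ha W R V x).trans (h W R V x)⟩

/-- Lets side conditions that do not depend on the model be mixed into defining formulas. -/
theorem const (p : Prop) : Expressible fun _ _ _ _ => p := by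
  by_cases hp : p
  · exact ⟨Formula.bot.imp .bot, fun _ _ _ _ => ⟨fun _ => hp, fun _ => id⟩⟩
  · exact ⟨.bot, fun _ _ _ _ => ⟨False.elim, hp⟩⟩

theorem not (hP : Expressible P) : Expressible fun W R V x => ¬ P W R V x :=
  hP.imp (const False)

theorem and (hP : Expressible P) (hQ : Expressible Q) :
    Expressible fun W R V x => P W R V x ∧ Q W R V x :=
  (hP.imp hQ.not).not.congr fun _ _ _ _ => by tauto

theorem iff (hP : Expressible P) (hQ : Expressible Q) :
    Expressible fun W R V x => (P W R V x ↔ Q W R V x) :=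
  ((hP.imp hQ).and (hQ.imp hP)).congr fun _ _ _ _ => iff_def.symm

theorem diamond (hP : Expressible P) :
    Expressible fun W R V x => ∃ y, R x y ∧ P W R V y :=
  hP.not.box.not.congr fun _ _ _ _ => by push Not; rfl

theorem forall_lt {P : ℕ → ∀ W : Type, (W → W → Prop) → (ℕ → W → Prop) → W → Prop}
    (hP : ∀ i, Expressible (P i)) (n : ℕ) :
    Expressible fun W R V x => ∀ i < n, P i W R V x := by
  induction n with
  | zero => exact (const True).congr fun _ _ _ _ => by simp
  | succ n ih => exact (ih.and (hP n)).congr fun _ _ _ _ => Nat.forall_lt_succ_right.symm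

theorem exists_lt {P : ℕ → ∀ W : Type, (W → W → Prop) → (ℕ → W → Prop) → W → Prop}
    (hP : ∀ i, Expressible (P i)) (n : ℕ) :
    Expressible fun W R V x => ∃ i < n, P i W R V x :=
  (forall_lt (fun i => (hP i).not) n).not.congr fun _ _ _ _ => by push Not; rfl

end Expressible

/-- A bound for the codes of `k`-bisimulation types over `c` variables. -/
def typeBound (c : ℕ) : ℕ → ℕ
  | 0 => (2 ^ c) ^ 2
  | k + 1 => (2 ^ c + 2 ^ typeBound c k) ^ 2

section Types

variable {W : Type} (R : W → W → Prop) (V : ℕ → W → Prop) (c : ℕ)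

/-- The code of the valuation of the first `c` variables at a point. -/
noncomputable def valCode (x : W) : ℕ := encodeSet c fun i => V i x

/-- The code of the `k`-bisimulation type of a point over the first `c` variables. -/
noncomputable def typeCode : ℕ → W → ℕ
  | 0, x => Nat.pair (valCode V c x) 0
  | k + 1, x => Nat.pair (valCode V c x)
      (encodeSet (typeBound c k) fun s => ∃ y, R x y ∧ typeCode k y = s)

theorem typeCode_lt (k : ℕ) (x : W) : typeCode R V c k x < typeBound c k := by
  have h : valCode V c x < 2 ^ c := encodeSet_lt _ _
  cases k with
  | zero =>
    refine (Nat.pair_lt_max_add_one_sq _ _).trans_le (Nat.pow_le_pow_left ?_ 2)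
    rw [max_eq_left (Nat.zero_le _)]
    exact h
  | succ k =>
    refine (Nat.pair_lt_max_add_one_sq _ _).trans_le (Nat.pow_le_pow_left ?_ 2)
    have h' := encodeSet_lt (typeBound c k) fun s => ∃ y, R x y ∧ typeCode R V c k y = s
    omega

theorem unpair_typeCode_fst (k : ℕ) (x : W) :
    (Nat.unpair (typeCode R V c k x)).1 = valCode V c x := by
  cases k <;> simp [typeCode]

theorem bit_unpair_typeCode_snd {k s : ℕ} {x : W} :
    Bit (Nat.unpair (typeCode R V c (k + 1) x)).2 s ↔ ∃ y, R x y ∧ typeCode R V c k y = s := by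
  rw [typeCode, Nat.unpair_pair, bit_encodeSet]
  refine and_iff_right_of_imp ?_
  rintro ⟨y, -, rfl⟩
  exact typeCode_lt R V c k y

theorem valCode_eq_iff {a : ℕ} {x : W} :
    valCode V c x = a ↔ a < 2 ^ c ∧ ∀ i < c, (Bit a i ↔ V i x) :=
  encodeSet_eq_iff

/-- A type records a valuation of finitely many variables and the finite set of types of the
successors. By induction on k the latter is described by diamonds. -/
theorem expressible_typeCode_eq (k s : ℕ) :
    Expressible fun _ R V x => typeCode R V c k x = s := by
  have hv : ∀ a, Expressible fun _ _ V x => valCode V c x = a := fun a =>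
    ((Expressible.const (a < 2 ^ c)).and
      (.forall_lt (fun i => (Expressible.const (Bit a i)).iff (.var i)) c)).congr
      fun _ _ _ _ => (valCode_eq_iff _ _).symm
  have hpair : ∀ {a b s : ℕ}, Nat.pair a b = s ↔ a = s.unpair.1 ∧ b = s.unpair.2 := by
    intro a b s
    rw [← Nat.pair_eq_pair, Nat.pair_unpair]
  induction k generalizing s with
  | zero =>
    exact ((hv s.unpair.1).and (.const (0 = s.unpair.2))).congr fun _ _ _ _ => hpair.symm
  | succ k ih =>
    refine ((hv s.unpair.1).and ((Expressible.const (s.unpair.2 < 2 ^ typeBound c k)).and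
      (.forall_lt (fun i => (Expressible.const (Bit s.unpair.2 i)).iff (ih i).diamond)
        (typeBound c k)))).congr fun W R V x => ?_
    rw [typeCode, hpair, encodeSet_eq_iff]

/-- The modal depth of a formula. -/
def depth : Formula → ℕ
  | var _ => 0
  | bot => 0
  | imp φ ψ => max φ.depth ψ.depth
  | box φ => φ.depth + 1

theorem code_left_lt (a b : Formula) : a.code < (a.imp b).code := by
  have := Nat.left_le_pair a.code b.code
  simp only [code]
  omega

theorem code_right_lt (a b : Formula) : b.code < (a.imp b).code := by
  have := Nat.right_le_pair a.code b.code
  simp only [code]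
  omega

theorem code_lt_box (a : Formula) : a.code < a.box.code := by
  simp only [code]
  omega

/-- With this, the code of φ alone serves as a bound for both its variables and its modal depth. -/
theorem depth_le_code (φ : Formula) : φ.depth ≤ φ.code := by
  induction φ with
  | var n => exact Nat.zero_le _
  | bot => exact Nat.zero_le _
  | imp a b iha ihb =>
    exact max_le (iha.trans (code_left_lt a b).le) (ihb.trans (code_right_lt a b).le)
  | box a iha => exact iha.trans_lt (code_lt_box a)

theorem valCode_congr {k : ℕ} {x y : W} (h : typeCode R V c k x = typeCode R V c k y) :
    valCode V c x = valCode V c y := by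
  rw [← unpair_typeCode_fst R V c k x, h, unpair_typeCode_fst]

theorem exists_succ_of_typeCode_eq {k : ℕ} {x x' y : W}
    (h : typeCode R V c (k + 1) x = typeCode R V c (k + 1) x') (hy : R x y) :
    ∃ y', R x' y' ∧ typeCode R V c k y' = typeCode R V c k y := by
  rw [← bit_unpair_typeCode_snd, ← h, bit_unpair_typeCode_snd]
  exact ⟨y, hy, rfl⟩

variable {c} in
theorem val_iff_of_valCode_eq {i : ℕ} (hi : i < c) {x y : W}
    (h : valCode V c x = valCode V c y) : V i x ↔ V i y := by
  rw [← ((valCode_eq_iff V c).mp h).2 i hi, valCode, bit_encodeSet, and_iff_right hi]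

theorem sat_iff_of_typeCode_eq {φ : Formula} {k : ℕ} (hk : φ.depth ≤ k) (hc : φ.code ≤ c)
    {x y : W} (h : typeCode R V c k x = typeCode R V c k y) :
    φ.Sat R V x ↔ φ.Sat R V y := by
  induction φ generalizing k x y with
  | var n =>
    have : n < c := by simp only [code] at hc; omega
    exact val_iff_of_valCode_eq V this (valCode_congr R V c h)
  | bot => rfl
  | imp a b iha ihb =>
    exact imp_congr (iha ((le_max_left _ _).trans hk) ((code_left_lt a b).le.trans hc) h)
      (ihb ((le_max_right _ _).trans hk) ((code_right_lt a b).le.trans hc) h)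
  | box a iha =>
    obtain ⟨k, rfl⟩ : ∃ j, k = j + 1 := ⟨k - 1, by simp only [depth] at hk; omega⟩
    have hk' : a.depth ≤ k := Nat.le_of_succ_le_succ hk
    have key : ∀ {x y : W}, typeCode R V c (k + 1) x = typeCode R V c (k + 1) y →
        a.box.Sat R V x → a.box.Sat R V y := by
      intro x y h hx z hz
      obtain ⟨z', hz', e⟩ := exists_succ_of_typeCode_eq R V c h.symm hz
      exact (iha hk' ((code_lt_box a).le.trans hc) e).mp (hx z' hz')
    exact ⟨key h, key h.symm⟩

/-- The filtration lemma, for the least filtration through the `k`-bisimulation types. -/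
theorem sat_filtration {φ : Formula} {k : ℕ} (hk : φ.depth ≤ k) (hc : φ.code ≤ c)
    {Rf : ℕ → ℕ → Prop}
    (hR : ∀ w u, Rf w u ↔ ∃ x y, R x y ∧ typeCode R V c k x = w ∧ typeCode R V c k y = u)
    (x : W) :
    φ.Sat Rf (fun p w => ∃ y, typeCode R V c k y = w ∧ V p y) (typeCode R V c k x) ↔
      φ.Sat R V x := by
  induction φ generalizing x with
  | var n =>
    refine ⟨?_, fun h => ⟨x, rfl, h⟩⟩
    rintro ⟨y, hy, h⟩
    exact (sat_iff_of_typeCode_eq R V c hk hc hy).mp h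
  | bot => rfl
  | imp a b iha ihb =>
    exact imp_congr (iha ((le_max_left _ _).trans hk) ((code_left_lt a b).le.trans hc) x)
      (ihb ((le_max_right _ _).trans hk) ((code_right_lt a b).le.trans hc) x)
  | box a iha =>
    have hk' : a.depth ≤ k := (Nat.le_succ _).trans hk
    have hc' : a.code ≤ c := (code_lt_box a).le.trans hc
    constructor
    · intro h y hy
      exact (iha hk' hc' y).mp (h _ ((hR _ _).mpr ⟨x, y, hy, rfl, rfl⟩))
    · intro h u hu
      obtain ⟨x', y', hxy, hx, rfl⟩ := (hR _ _).mp hu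
      exact (iha hk' hc' y').mpr
        ((sat_iff_of_typeCode_eq R V c hk hc hx).mpr h y' hxy)

/-! ### Points of bounded height -/

/-- Every chain of successors from the point has length at most `n`. -/
def HeightLE : ℕ → W → Prop
  | 0, x => ∀ y, ¬ R x y
  | n + 1, x => ∀ y, R x y → HeightLE n y

variable {R} in
theorem HeightLE.succ {n : ℕ} {x : W} (h : HeightLE R n x) : HeightLE R (n + 1) x := by
  induction n generalizing x with
  | zero => exact fun y hy => absurd hy (h y)
  | succ n ih => exact fun y hy => ih (h y hy)

variable {R} in
theorem HeightLE.mono {m n : ℕ} (hmn : m ≤ n) {x : W} (h : HeightLE R m x) : HeightLE R n x := by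
  induction hmn with
  | refl => exact h
  | step _ ih => exact ih.succ

variable {R} in
theorem HeightLE.of_rel {n : ℕ} {x y : W} (h : HeightLE R n x) (hxy : R x y) :
    ∃ m, n = m + 1 ∧ HeightLE R m y := by
  cases n with
  | zero => exact absurd hxy (h y)
  | succ n => exact ⟨n, rfl, h y hxy⟩

theorem expressible_heightLE (n : ℕ) : Expressible fun _ R _ x => HeightLE R n x := by
  induction n with
  | zero => exact (Expressible.const False).box
  | succ n ih => exact ih.box

variable {R} in
theorem HeightLE.of_typeCode_eq {n k : ℕ} (hnk : n < k) {x y : W} (hx : HeightLE R n x)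
    (h : typeCode R V c k x = typeCode R V c k y) : HeightLE R n y := by
  induction n generalizing k x y with
  | zero =>
    obtain ⟨k, rfl⟩ : ∃ j, k = j + 1 := ⟨k - 1, by omega⟩
    intro z hz
    obtain ⟨z', hz', -⟩ := exists_succ_of_typeCode_eq R V c h.symm hz
    exact hx z' hz'
  | succ n ih =>
    obtain ⟨k, rfl⟩ : ∃ j, k = j + 1 := ⟨k - 1, by omega⟩
    intro z hz
    obtain ⟨z', hz', e⟩ := exists_succ_of_typeCode_eq R V c h.symm hz
    exact ih (Nat.lt_of_succ_lt_succ hnk) (hx z' hz') e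

variable {R} in
-- Once the depth reaches the height, types stop growing. The codes agree literally because they do
-- not record the depth.
theorem HeightLE.typeCode_succ {n k : ℕ} (hnk : n ≤ k) {x : W} (hx : HeightLE R n x) :
    typeCode R V c (k + 1) x = typeCode R V c k x := by
  induction k generalizing n x with
  | zero =>
    -- A dead end has an empty set of successor types, whose code is 0, the second component used at
    -- depth 0.
    obtain rfl : n = 0 := Nat.le_zero.mp hnk
    simp only [typeCode]
    rw [encodeSet_eq_iff.mpr ⟨by positivity, fun i _ => ?_⟩]
    simp only [Bit, Nat.zero_testBit, Bool.false_eq_true, false_iff]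
    rintro ⟨y, hy, -⟩
    exact hx y hy
  | succ k ih =>
    refine Nat.pair_unpair (typeCode R V c (k + 1 + 1) x) ▸
      Nat.pair_unpair (typeCode R V c (k + 1) x) ▸ Nat.pair_eq_pair.mpr ⟨?_, ?_⟩
    · rw [unpair_typeCode_fst, unpair_typeCode_fst]
    · refine eq_of_bit_iff fun s => ?_
      rw [bit_unpair_typeCode_snd, bit_unpair_typeCode_snd]
      refine exists_congr fun y => and_congr_right fun hy => ?_
      obtain ⟨m, rfl, hm⟩ := hx.of_rel hy
      rw [ih (Nat.le_of_succ_le_succ hnk) hm]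

/-- At points of small height the type map satisfies the back condition of a p-morphism. -/
theorem HeightLE.exists_succ {R : W → W → Prop} {n k : ℕ} (hnk : n < k) {x x' y' : W}
    (hx : HeightLE R n x) (h : typeCode R V c k x = typeCode R V c k x') (hy : R x' y') :
    ∃ y, R x y ∧ typeCode R V c k y = typeCode R V c k y' := by
  obtain ⟨k, rfl⟩ : ∃ j, k = j + 1 := ⟨k - 1, by omega⟩
  obtain ⟨y, hxy, e⟩ := exists_succ_of_typeCode_eq R V c h.symm hy
  obtain ⟨m, rfl, hm⟩ := hx.of_rel hxy
  obtain ⟨m', hm', hmy'⟩ := (hx.of_typeCode_eq V c hnk h).of_rel hy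
  refine ⟨y, hxy, ?_⟩
  -- The successors agree only one depth lower, but both have height below `k`, so that depth
  -- already fixes their types.
  rw [hm.typeCode_succ V c (by omega), hmy'.typeCode_succ V c (by omega), e]

/-- The code of the successor is a digit position in the code of the successor set, hence smaller.
This makes the filtration acyclic, with codes descending along the relation. -/
theorem HeightLE.typeCode_lt_of_rel {R : W → W → Prop} {n k : ℕ} (hnk : n < k) {x y : W}
    (hx : HeightLE R n x) (hy : R x y) : typeCode R V c k y < typeCode R V c k x := by
  obtain ⟨k, rfl⟩ : ∃ j, k = j + 1 := ⟨k - 1, by omega⟩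
  obtain ⟨m, rfl, hm⟩ := hx.of_rel hy
  rw [hm.typeCode_succ V c (by omega)]
  exact ((bit_unpair_typeCode_snd R V c).mpr ⟨y, hy, rfl⟩).lt.trans_le (Nat.unpair_right_le _)

end Types

/-! ### Truncation by a countdown -/

/-- The product of a relation with a countdown of at most `n` steps. -/
def truncate {W : Type} (R : W → W → Prop) (n : ℕ) (x y : W × ℕ) : Prop :=
  R x.1 y.1 ∧ x.2 = y.2 + 1 ∧ x.2 ≤ n

theorem sat_truncate {W : Type} (R : W → W → Prop) (V : ℕ → W → Prop) {φ : Formula} {n i : ℕ}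
    (hi : φ.depth ≤ i) (hn : i ≤ n) (x : W) :
    φ.Sat (truncate R n) (fun p x => V p x.1) (x, i) ↔ φ.Sat R V x := by
  induction φ generalizing i x with
  | var n => rfl
  | bot => rfl
  | imp a b iha ihb =>
    exact imp_congr (iha ((le_max_left _ _).trans hi) hn x)
      (ihb ((le_max_right _ _).trans hi) hn x)
  | box a iha =>
    obtain ⟨i, rfl⟩ : ∃ j, i = j + 1 := ⟨i - 1, by simp only [depth] at hi; omega⟩
    have ih := fun y => iha (Nat.le_of_succ_le_succ hi) ((Nat.le_succ i).trans hn) y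
    constructor
    · exact fun h y hy => (ih y).mp (h (y, i) ⟨hy, rfl, hn⟩)
    · rintro h ⟨y, j⟩ ⟨hy, hj, -⟩
      obtain rfl : i = j := Nat.succ_injective hj
      exact (ih y).mpr (h y hy)

theorem heightLE_truncate {W : Type} (R : W → W → Prop) (n : ℕ) (x : W × ℕ) :
    HeightLE (truncate R n) n x := by
  have key : ∀ i (x : W × ℕ), x.2 ≤ i → HeightLE (truncate R n) i x := by
    intro i
    induction i with
    | zero => intro x hx y hy; have := hy.2.1; omega
    | succ i ih => intro x hx y hy; exact ih y (by have := hy.2.1; omega)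
  by_cases h : x.2 ≤ n
  · exact key n x h
  -- Points whose counter exceeds `n` are dead ends by definition.
  · have h0 : HeightLE (truncate R n) 0 x := fun y hy => h hy.2.2
    exact h0.mono (Nat.zero_le n)

end Formula

/-! ### Functional bisimulations and Jankov–Fine formulas -/

/-- A functional bisimulation: a p-morphism from a generated subframe. -/
structure IsFunBisim {W W' : Type} (R : W → W → Prop) (R' : W' → W' → Prop)
    (Z : W → W' → Prop) : Prop where
  functional : ∀ {x s s'}, Z x s → Z x s' → s = s'
  forth : ∀ {x s y}, Z x s → R x y → ∃ s', R' s s' ∧ Z y s'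
  back : ∀ {x s s'}, Z x s → R' s s' → ∃ y, R x y ∧ Z y s'

namespace Formula

theorem sat_iff_of_isFunBisim {W W' : Type} {R : W → W → Prop} {R' : W' → W' → Prop}
    {Z : W → W' → Prop} (hZ : IsFunBisim R R' Z) (U : ℕ → W' → Prop) (φ : Formula) {x : W}
    {s : W'} (h : Z x s) :
    φ.Sat R (fun p y => ∃ u, Z y u ∧ U p u) x ↔ φ.Sat R' U s := by
  induction φ generalizing x s with
  | var n =>
    refine ⟨?_, fun hs => ⟨s, h, hs⟩⟩
    rintro ⟨u, hu, hU⟩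
    exact hZ.functional hu h ▸ hU
  | bot => rfl
  | imp a b iha ihb => exact imp_congr (iha h) (ihb h)
  | box a iha =>
    constructor
    · intro hx s' hs'
      obtain ⟨y, hy, hys⟩ := hZ.back h hs'
      exact (iha hys).mp (hx y hy)
    · intro hs y hy
      obtain ⟨s', hs', hys⟩ := hZ.forth h hy
      exact (iha hys).mpr (hs s' hs')

theorem expressible_typeCode (c k : ℕ) (A : ℕ → Prop) :
    Expressible fun _ R V x => A (typeCode R V c k x) := by
  refine (Expressible.exists_lt (fun w => (expressible_typeCode_eq c k w).and (.const (A w)))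
    (typeBound c k)).congr fun W R V x => ?_
  constructor
  · rintro ⟨w, -, rfl, h⟩
    exact h
  · exact fun h => ⟨_, typeCode_lt R V c k x, rfl, h⟩

/-- A logic valid in a model is valid at the points matched by a functional bisimulation
that only depends on the types. -/
theorem sat_of_isFunBisim_typeCode {L : NormalLogic} {W W' : Type} {R : W → W → Prop}
    {V : ℕ → W → Prop} (hL : ∀ φ ∈ L.carrier, ∀ x, φ.Sat R V x) {c k : ℕ}
    {R' : W' → W' → Prop} {Q : ℕ → W' → Prop}
    (hQ : IsFunBisim R R' fun x s => Q (typeCode R V c k x) s) {x : W} {s : W'}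
    (hs : Q (typeCode R V c k x) s) (U : ℕ → W' → Prop) {φ : Formula} (hφ : φ ∈ L.carrier) :
    φ.Sat R' U s := by
  -- The pullback of the valuation `U` along `Q` is a union of types, hence definable. Substituting
  -- the defining formulas turns validity of the logic in one model into truth under `U`.
  choose σ hσ using fun p => expressible_typeCode c k fun w => ∃ u, Q w u ∧ U p u
  have h := (sat_subst R V σ φ x).mp (hL _ (L.subst_mem σ φ hφ) x)
  simp only [hσ] at h
  exact (sat_iff_of_isFunBisim hQ U φ hs).mp h

/-- `P` holds at all points reachable in at most `n` steps. -/
def Hereditarily (P : ∀ W : Type, (W → W → Prop) → (ℕ → W → Prop) → W → Prop) :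
    ℕ → ∀ W : Type, (W → W → Prop) → (ℕ → W → Prop) → W → Prop
  | 0, W, R, V, x => P W R V x
  | n + 1, W, R, V, x => P W R V x ∧ ∀ y, R x y → Hereditarily P n W R V y

theorem Expressible.hereditarily
    {P : ∀ W : Type, (W → W → Prop) → (ℕ → W → Prop) → W → Prop} (hP : Expressible P) (n : ℕ) :
    Expressible (Hereditarily P n) := by
  induction n with
  | zero => exact hP
  | succ n ih => exact hP.and ih.box

section Hereditarily

variable {P : ∀ W : Type, (W → W → Prop) → (ℕ → W → Prop) → W → Prop} {W : Type}
  {R : W → W → Prop} {V : ℕ → W → Prop}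

theorem Hereditarily.self {n : ℕ} {x : W} (h : Hereditarily P n W R V x) : P W R V x := by
  cases n with
  | zero => exact h
  | succ n => exact h.1

theorem Hereditarily.of_succ {n : ℕ} {x : W} (h : Hereditarily P (n + 1) W R V x) :
    Hereditarily P n W R V x := by
  induction n generalizing x with
  | zero => exact h.1
  | succ n ih => exact ⟨h.1, fun y hy => ih (h.2 y hy)⟩

theorem Hereditarily.mono {m n : ℕ} (hmn : m ≤ n) {x : W} (h : Hereditarily P n W R V x) :
    Hereditarily P m W R V x := by
  induction hmn with
  | refl => exact h
  | step _ ih => exact ih h.of_succ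

theorem hereditarily_of_forall (h : ∀ x, P W R V x) (n : ℕ) (x : W) :
    Hereditarily P n W R V x := by
  induction n generalizing x with
  | zero => exact h x
  | succ n ih => exact ⟨h x, fun y _ => ih y⟩

end Hereditarily

/-- The local conditions for the first `m` variables to describe a p-morphism to `S`. -/
def LocalDiagram (S : ℕ → ℕ → Prop) (m : ℕ) (W : Type) (R : W → W → Prop) (V : ℕ → W → Prop)
    (x : W) : Prop :=
  ∀ w < m, V w x → (∀ u < m, V u x → w = u) ∧ (∀ y, R x y → ∃ u < m, S w u ∧ V u y) ∧
    ∀ u < m, S w u → ∃ y, R x y ∧ V u y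

theorem expressible_localDiagram (S : ℕ → ℕ → Prop) (m : ℕ) :
    Expressible (LocalDiagram S m) :=
  .forall_lt (fun w => (Expressible.var w).imp
    ((Expressible.forall_lt (fun u => (Expressible.var u).imp (.const (w = u))) m).and
      ((Expressible.exists_lt (fun u => (Expressible.const (S w u)).and (.var u)) m).box.and
        (.forall_lt (fun u => (Expressible.const (S w u)).imp (Expressible.var u).diamond) m)))) m

/-- If every formula valid in a frame holds at a point of a finite acyclic frame, then the
subframe generated by that point is a p-morphic image of a generated subframe. -/
theorem exists_isFunBisim {W : Type} {R : W → W → Prop} {D : Set W} {S : ℕ → ℕ → Prop} {m s : ℕ}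
    (hS : ∀ w u, S w u → u < w ∧ w < m) (hs : s < m)
    (h : ∀ χ : Formula, (∀ V, ∀ x ∈ D, χ.Sat R V x) → ∀ U, χ.Sat S U s) :
    ∃ Z : W → ℕ → Prop, IsFunBisim R S Z ∧ (∃ g ∈ D, Z g s) := by
  -- The negated diagram of the frame at `s` fails there when variable w names the point w, so it is
  -- refuted on `D`; a refuting valuation encodes the p-morphism.
  obtain ⟨χ, hχ⟩ := ((Expressible.var s).and
    ((expressible_localDiagram S m).hereditarily m)).not
  have hnot : ¬ ∀ V, ∀ x ∈ D, χ.Sat R V x := by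
    refine fun hall => (hχ _ _ _ _).mp (h χ hall fun w u => w = u)
      ⟨rfl, hereditarily_of_forall ?_ m s⟩
    rintro x w - rfl
    refine ⟨fun u _ hu => hu.symm, fun y hy => ?_, fun u _ hu => ⟨u, hu, rfl⟩⟩
    exact ⟨y, (hS _ _ hy).1.trans (hS _ _ hy).2, hy, rfl⟩
  push Not at hnot
  obtain ⟨V, g, hg, hgχ⟩ := hnot
  rw [hχ, not_not] at hgχ
  -- The point `w` itself counts the remaining steps: `S` descends, so depth `w` is enough to
  -- continue.
  refine ⟨fun x w => w < m ∧ V w x ∧ Hereditarily (LocalDiagram S m) w W R V x,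
    ⟨?_, ?_, ?_⟩, g, hg, hs, hgχ.1, hgχ.2.mono hs.le⟩
  · rintro x w u ⟨hw, hwx, hher⟩ ⟨hu, hux, -⟩
    exact (hher.self w hw hwx).1 u hu hux
  · rintro x w y ⟨hw, hwx, hher⟩ hy
    obtain ⟨u, hu, hwu, huy⟩ := (hher.self w hw hwx).2.1 y hy
    obtain ⟨j, rfl⟩ : ∃ j, w = j + 1 := ⟨w - 1, by have := (hS _ _ hwu).1; omega⟩
    exact ⟨u, hwu, hu, huy, (hher.2 y hy).mono (Nat.le_of_lt_succ (hS _ _ hwu).1)⟩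
  · rintro x w u ⟨hw, hwx, hher⟩ hwu
    have hu : u < m := (hS _ _ hwu).1.trans hw
    obtain ⟨y, hy, huy⟩ := (hher.self w hw hwx).2.2 u hu hwu
    obtain ⟨j, rfl⟩ : ∃ j, w = j + 1 := ⟨w - 1, by have := (hS _ _ hwu).1; omega⟩
    exact ⟨y, hy, hu, huy, (hher.2 y hy).mono (Nat.le_of_lt_succ (hS _ _ hwu).1)⟩

end Formula

/-! ### Coded frames and the bounded criterion -/

/-- The relation coded by `N` on the set of points coded by `D`. -/
def CodedRel (D N w u : ℕ) : Prop := Bit D w ∧ Bit D u ∧ Bit N (Nat.pair w u)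

/-- `t` codes the truth values, at the points of a coded frame, of the formulas with code at
most `c`. -/
def IsTruthTable (c D N t : ℕ) : Prop :=
  ∀ w, Bit D w → ¬ Bit t (Nat.pair 0 w) ∧
    (∀ i j, 3 * Nat.pair i j + 2 ≤ c → (Bit t (Nat.pair (3 * Nat.pair i j + 2) w) ↔
      (Bit t (Nat.pair i w) → Bit t (Nat.pair j w)))) ∧
    ∀ i, 3 * i + 3 ≤ c → (Bit t (Nat.pair (3 * i + 3) w) ↔
      ∀ u, CodedRel D N w u → Bit t (Nat.pair i u))

/-- A truth table with code below `b` refutes the formula with code `c` in a coded frame. -/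
def Refutes (b c D N : ℕ) : Prop :=
  ∃ t < b, IsTruthTable c D N t ∧ ∃ w, Bit D w ∧ ¬ Bit t (Nat.pair c w)

/-- A bound for codes of relations between numbers below `a` and numbers below `b`. -/
def codeBound (a b : ℕ) : ℕ := 2 ^ (a + b + 1) ^ 2

theorem pair_lt_sq {a b x y : ℕ} (hx : x ≤ a) (hy : y ≤ b) :
    Nat.pair x y < (a + b + 1) ^ 2 :=
  (Nat.pair_lt_max_add_one_sq x y).trans_le (Nat.pow_le_pow_left (by omega) 2)

/-- The entries for variables are unconstrained, so they can be read as a valuation. -/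
theorem IsTruthTable.bit_iff {c D N t : ℕ} (ht : IsTruthTable c D N t) {φ : Formula}
    (hφ : φ.code ≤ c) {w : ℕ} (hw : Bit D w) :
    Bit t (Nat.pair φ.code w) ↔
      φ.Sat (CodedRel D N) (fun p u => Bit t (Nat.pair (3 * p + 1) u)) w := by
  induction φ generalizing w with
  | var n => rfl
  | bot => exact ⟨(ht w hw).1, False.elim⟩
  | imp a b iha ihb =>
    exact ((ht w hw).2.1 _ _ hφ).trans
      (imp_congr (iha ((Formula.code_left_lt a b).le.trans hφ) hw)
        (ihb ((Formula.code_right_lt a b).le.trans hφ) hw))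
  | box a iha =>
    exact ((ht w hw).2.2 _ hφ).trans (forall₂_congr fun u hu =>
      iha ((Formula.code_lt_box a).le.trans hφ) hu.2.1)

theorem Refutes.exists_not_sat {b D N : ℕ} {φ : Formula} (h : Refutes b φ.code D N) :
    ∃ (U : ℕ → ℕ → Prop) (w : ℕ), Bit D w ∧ ¬ φ.Sat (CodedRel D N) U w := by
  obtain ⟨t, -, ht, w, hw, hφ⟩ := h
  exact ⟨_, w, hw, fun h => hφ ((ht.bit_iff le_rfl hw).mpr h)⟩

theorem refutes_of_not_sat {D N T : ℕ} (hD : D < 2 ^ T) {φ : Formula} {U : ℕ → ℕ → Prop} {w : ℕ}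
    (hw : Bit D w) (h : ¬ φ.Sat (CodedRel D N) U w) :
    Refutes (codeBound φ.code T) φ.code D N := by
  set t := encodeSet ((φ.code + T + 1) ^ 2) fun p =>
    (Formula.codeEquiv.symm p.unpair.1).Sat (CodedRel D N) U p.unpair.2 with ht
  have key : ∀ (ψ : Formula) {u : ℕ}, ψ.code ≤ φ.code → Bit D u →
      (Bit t (Nat.pair ψ.code u) ↔ ψ.Sat (CodedRel D N) U u) := by
    intro ψ u hψ hu
    rw [ht, bit_encodeSet, and_iff_right (pair_lt_sq hψ (hu.lt_of_lt_two_pow hD).le),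
      Nat.unpair_pair, show ψ.code = Formula.codeEquiv ψ from rfl, Equiv.symm_apply_apply]
  refine ⟨t, encodeSet_lt _ _, fun u hu => ⟨?_, fun i j hij => ?_, fun i hi => ?_⟩, w, hw,
    fun h' => h ((key φ le_rfl hw).mp h')⟩
  · exact fun h' => (key .bot (Nat.zero_le _) hu).mp h'
  · obtain ⟨a, rfl⟩ := Formula.code_surjective i
    obtain ⟨b, rfl⟩ := Formula.code_surjective j
    exact (key (a.imp b) hij hu).trans (imp_congr
      (key a ((Formula.code_left_lt a b).le.trans hij) hu).symm
      (key b ((Formula.code_right_lt a b).le.trans hij) hu).symm)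
  · obtain ⟨a, rfl⟩ := Formula.code_surjective i
    exact (key a.box hi hu).trans (forall₂_congr fun v hv =>
      (key a ((Formula.code_lt_box a).le.trans hi) hv.2.1).symm)

open Formula in
/-- The filtration of a model through its types, as a coded frame. -/
theorem exists_coded_filtration {W : Type} (R : W → W → Prop) (V : ℕ → W → Prop) (c k : ℕ) :
    ∃ D < codeBound c (typeBound c k), ∃ N < codeBound c (typeBound c k),
      D < 2 ^ typeBound c k ∧ (∀ w, Bit D w ↔ ∃ x, typeCode R V c k x = w) ∧
      ∀ w u, CodedRel D N w u ↔
        ∃ x y, R x y ∧ typeCode R V c k x = w ∧ typeCode R V c k y = u := by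
  set T := typeBound c k
  have hD : ∀ w, Bit (encodeSet T fun w => ∃ x, typeCode R V c k x = w) w ↔
      ∃ x, typeCode R V c k x = w := by
    intro w
    rw [bit_encodeSet]
    refine and_iff_right_of_imp ?_
    rintro ⟨x, rfl⟩
    exact typeCode_lt R V c k x
  refine ⟨encodeSet T fun w => ∃ x, typeCode R V c k x = w, ?_,
    encodeSet (T ^ 2) fun p => ∃ x y, R x y ∧
      Nat.pair (typeCode R V c k x) (typeCode R V c k y) = p, ?_, encodeSet_lt _ _, hD, ?_⟩
  · exact (encodeSet_lt _ _).trans_le (Nat.pow_le_pow_right two_pos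
      ((by omega : T ≤ c + T + 1).trans (Nat.le_self_pow two_ne_zero _)))
  · exact (encodeSet_lt _ _).trans_le
      (Nat.pow_le_pow_right two_pos (Nat.pow_le_pow_left (by omega) 2))
  · intro w u
    rw [CodedRel, hD, hD, bit_encodeSet]
    constructor
    · rintro ⟨-, -, -, x, y, hxy, e⟩
      exact ⟨x, y, hxy, Nat.pair_eq_pair.mp e⟩
    · rintro ⟨x, y, hxy, rfl, rfl⟩
      refine ⟨⟨x, rfl⟩, ⟨y, rfl⟩, ?_, x, y, hxy, rfl⟩
      refine (Nat.pair_lt_max_add_one_sq _ _).trans_le (Nat.pow_le_pow_left ?_ 2)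
      exact max_lt (typeCode_lt R V c k x) (typeCode_lt R V c k y)

/-- A bound for the size of the frames that can split the lattice. -/
def frameBound (c : ℕ) : ℕ := codeBound c (Formula.typeBound c (c + 1))

/-- A bound for the size of the frames on which a splitting has to be tested. -/
def testBound (c : ℕ) : ℕ := codeBound c (Formula.typeBound c (frameBound c + c))

/-- `Z` codes a functional bisimulation between coded frames. -/
def CodesFunBisim (D N D' N' Z : ℕ) : Prop :=
  IsFunBisim (CodedRel D N) (CodedRel D' N') fun w s => Bit D w ∧ Bit D' s ∧ Bit Z (Nat.pair w s)

/-- Some finite acyclic frame refutes the formula with code `c` and every point of it generates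
a p-morphic image of a generated subframe of each small frame that refutes the formula. -/
def CodesSplitting (c : ℕ) : Prop :=
  ∃ D' < frameBound c, ∃ N' < frameBound c, (∀ w u, CodedRel D' N' w u → u < w) ∧
    Refutes (frameBound c) c D' N' ∧
    ∀ D < testBound c, ∀ N < testBound c, Refutes (testBound c) c D N →
      ∀ s, Bit D' s → ∃ Z < codeBound (testBound c) (frameBound c),
        (∃ g, Bit D g ∧ Bit Z (Nat.pair g s)) ∧ CodesFunBisim D N D' N' Z

/-! ### Equivalence of splitting with the criterion -/

namespace NormalLogic

open Formula

/-- The logic of a coded frame. -/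
def codedLogic (D N : ℕ) : NormalLogic :=
  frameLogic (CodedRel D N) {w | Bit D w} fun _ _ _ h => h.2.1

theorem Refutes.notMem_codedLogic {b D N : ℕ} {φ : Formula} (h : Refutes b φ.code D N) :
    φ ∉ (codedLogic D N).carrier := by
  obtain ⟨U, w, hw, hφ⟩ := h.exists_not_sat
  exact fun hmem => hφ (hmem U w hw)

theorem isSplitting_of_codesSplitting {φ : Formula} (h : CodesSplitting φ.code) :
    IsSplitting (add K φ) := by
  obtain ⟨D', hD', N', -, hacyclic, href, htest⟩ := h
  refine ⟨⟨codedLogic D' N', Set.mem_Ici.mpr bot_le⟩, fun hle => ?_, fun z => ?_⟩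
  · exact Refutes.notMem_codedLogic href (add_le_iff.mp hle)
  rw [add_le_iff, or_iff_not_imp_left]
  intro hz θ hθ U s hs
  obtain ⟨W, R, V, hM⟩ := exists_model z.1
  rw [hM] at hz
  push Not at hz
  obtain ⟨x₀, hx₀⟩ := hz
  obtain ⟨D, hD, N, hN, hDT, hDmem, hrel⟩ :=
    exists_coded_filtration R V φ.code (frameBound φ.code + φ.code)
  set c := φ.code with hc
  -- The summand `c` covers the depth of φ; `frameBound c` exceeds every point of the acyclic frame,
  -- hence the height of every point matched with one.
  set k := frameBound c + c
  have hG : Refutes (testBound c) c D N :=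
    refutes_of_not_sat hDT ((hDmem _).mpr ⟨x₀, rfl⟩) fun hsat =>
      hx₀ ((sat_filtration R V c (k := k) (φ.depth_le_code.trans (Nat.le_add_left _ _)) le_rfl
        hrel x₀).mp hsat)
  obtain ⟨Z, -, ⟨g, hg, hgs⟩, hZ⟩ := htest D hD N hN hG s hs
  have hZ' : IsFunBisim (CodedRel D N) (CodedRel D' N') _ := hZ
  obtain ⟨x, rfl⟩ := (hDmem g).mp hg
  have hforth : ∀ {x y s}, Bit D' s → Bit Z (Nat.pair (typeCode R V c k x) s) → R x y →
      ∃ s', CodedRel D' N' s s' ∧ Bit Z (Nat.pair (typeCode R V c k y) s') := by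
    intro x y s hs hxs hxy
    obtain ⟨s', hs', h⟩ := hZ'.forth ⟨(hDmem _).mpr ⟨x, rfl⟩, hs, hxs⟩
      ((hrel _ _).mpr ⟨x, y, hxy, rfl, rfl⟩)
    exact ⟨s', hs', h.2.2⟩
  -- The forth condition sends chains from `x` to chains from `s`, and these descend in the natural
  -- numbers.
  have hheight : ∀ s x, Bit D' s → Bit Z (Nat.pair (typeCode R V c k x) s) →
      HeightLE R s x := by
    intro s
    induction s using Nat.strong_induction_on with
    | _ s ih =>
      intro x hs hxs
      cases s with
      | zero =>
        intro y hy
        obtain ⟨s', hs', -⟩ := hforth hs hxs hy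
        exact absurd (hacyclic _ _ hs') (Nat.not_lt_zero _)
      | succ s =>
        intro y hy
        obtain ⟨s', hs', h⟩ := hforth hs hxs hy
        exact (ih s' (hacyclic _ _ hs') y hs'.2.1 h).mono
          (Nat.le_of_lt_succ (hacyclic _ _ hs'))
  refine sat_of_isFunBisim_typeCode (L := z.1) (V := V) (fun ψ hψ => (hM ψ).mp hψ)
    (Q := fun w s => Bit D' s ∧ Bit Z (Nat.pair w s)) (c := c) (k := k) ⟨?_, ?_, ?_⟩
    (x := x) ⟨hs, hgs⟩ U hθ
  · intro x s s' h h'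
    have hx : Bit D (typeCode R V c k x) := (hDmem _).mpr ⟨x, rfl⟩
    exact hZ'.functional ⟨hx, h⟩ ⟨hx, h'⟩
  · intro x s y h hxy
    obtain ⟨s', hs', h'⟩ := hforth h.1 h.2 hxy
    exact ⟨s', hs', hs'.2.1, h'⟩
  · intro x s s' h hs'
    obtain ⟨w, hw, hws'⟩ := hZ'.back ⟨(hDmem _).mpr ⟨x, rfl⟩, h⟩ hs'
    -- An edge of the least filtration starts at some `x'` of the same type as `x`; bounded height
    -- transfers it to `x`.
    obtain ⟨x', y', hxy', e, rfl⟩ := (hrel _ _).mp hw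
    have hsk : s < k := (h.1.lt.trans hD').trans_le (Nat.le_add_right _ _)
    obtain ⟨y, hy, ey⟩ := (hheight s x h.1 h.2).exists_succ V c hsk e.symm hxy'
    refine ⟨y, hy, ?_⟩
    rw [ey]
    exact hws'.2

/-- The second component of a splitting pair has bounded height. -/
theorem exists_heightLE_of_isSplittingPair {φ : Formula} {y : NExt K}
    (h : IsSplittingPair (add K φ) y) {W : Type} {R : W → W → Prop} {V : ℕ → W → Prop}
    (hM : ∀ ψ : Formula, ψ ∈ y.1.carrier ↔ ∀ x, ψ.Sat R V x) (x : W) :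
    HeightLE R φ.code x := by
  obtain ⟨hne, hsplit⟩ := h
  rw [add_le_iff, hM] at hne
  push Not at hne
  obtain ⟨x₀, hx₀⟩ := hne
  -- The truncated frame still refutes φ, so its logic lies below `y`, which inherits the formula
  -- bounding the height.
  have hle := (hsplit ⟨frameLogic (truncate R φ.code) Set.univ fun _ _ _ _ => trivial,
    Set.mem_Ici.mpr bot_le⟩).resolve_left fun hle => hx₀ ((sat_truncate R V φ.depth_le_code le_rfl x₀).mp
      (add_le_iff.mp hle _ _ trivial))
  obtain ⟨χ, hχ⟩ := expressible_heightLE φ.code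
  exact (hχ _ _ _ _).mp ((hM χ).mp (hle fun V' x _ =>
    (hχ _ _ _ _).mpr (heightLE_truncate R φ.code x)) x)

theorem codesSplitting_of_isSplitting {φ : Formula} (h : IsSplitting (add K φ)) :
    CodesSplitting φ.code := by
  obtain ⟨y, hy⟩ := h
  obtain ⟨W, R, V, hM⟩ := exists_model y.1
  have hheight := exists_heightLE_of_isSplittingPair hy hM
  obtain ⟨hne, hsplit⟩ := hy
  rw [add_le_iff, hM] at hne
  push Not at hne
  obtain ⟨x₀, hx₀⟩ := hne
  -- The type depth exceeds the height bound `φ.code` by one, as the back condition for types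
  -- requires.
  obtain ⟨D', hD', N', hN', hDT, hDmem, hrel⟩ :=
    exists_coded_filtration R V φ.code (φ.code + 1)
  set c := φ.code with hc
  have hF : Refutes (frameBound c) c D' N' :=
    refutes_of_not_sat hDT ((hDmem _).mpr ⟨x₀, rfl⟩) fun hsat =>
      hx₀ ((sat_filtration R V c (φ.depth_le_code.trans (Nat.le_succ _)) le_rfl hrel x₀).mp hsat)
  have hacyclic : ∀ w u, CodedRel D' N' w u → u < w := by
    intro w u hwu
    obtain ⟨x, z, hxz, rfl, rfl⟩ := (hrel _ _).mp hwu
    exact (hheight x).typeCode_lt_of_rel V c (Nat.lt_succ_self _) hxz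
  have hyF : y.1 ≤ codedLogic D' N' := by
    intro θ hθ U s hs
    obtain ⟨x, rfl⟩ := (hDmem s).mp hs
    refine sat_of_isFunBisim_typeCode (L := y.1) (V := V) (fun ψ hψ => (hM ψ).mp hψ)
      (Q := fun w s => w = s) (c := c) (k := c + 1) ⟨?_, ?_, ?_⟩ (x := x) rfl U hθ
    · rintro x s s' rfl rfl
      rfl
    · rintro x s z rfl hxz
      exact ⟨_, (hrel _ _).mpr ⟨x, z, hxz, rfl, rfl⟩, rfl⟩
    · rintro x s s' rfl hs'
      obtain ⟨x', z', hxz', e, rfl⟩ := (hrel _ _).mp hs'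
      exact (hheight x).exists_succ V c (Nat.lt_succ_self _) e.symm hxz'
  refine ⟨D', hD', N', hN', hacyclic, hF, fun D hD N hN hG s hs => ?_⟩
  have hGy := (hsplit ⟨codedLogic D N, Set.mem_Ici.mpr bot_le⟩).resolve_left fun hle =>
    Refutes.notMem_codedLogic hG (add_le_iff.mp hle)
  have hGF : codedLogic D N ≤ codedLogic D' N' := le_trans hGy hyF
  -- Digit positions of `D'` are less than `D'`, so `D'` itself bounds the points.
  obtain ⟨Z, hZ, g, hg, hgs⟩ := exists_isFunBisim (D := {w | Bit D w}) (S := CodedRel D' N')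
    (m := D') (fun w u hwu => ⟨hacyclic w u hwu, hwu.1.lt⟩) hs.lt
    fun χ hχ U => hGF (a := χ) hχ U s hs
  set Zc := encodeSet ((testBound c + frameBound c + 1) ^ 2) fun p => Z p.unpair.1 p.unpair.2
    with hZc
  have hbit : ∀ {w u}, Bit D w → Bit D' u → (Bit Zc (Nat.pair w u) ↔ Z w u) := by
    intro w u hw hu
    have hu' : u ≤ frameBound c := (hu.lt.trans hD').le
    rw [hZc, bit_encodeSet, Nat.unpair_pair, and_iff_right (pair_lt_sq (hw.lt.trans hD).le hu')]
  refine ⟨Zc, encodeSet_lt _ _, ⟨g, hg, (hbit hg hs).mpr hgs⟩, ?_, ?_, ?_⟩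
  · rintro w u u' ⟨hw, hu, h⟩ ⟨-, hu', h'⟩
    exact hZ.functional ((hbit hw hu).mp h) ((hbit hw hu').mp h')
  · rintro w u v ⟨hw, hu, h⟩ hwv
    obtain ⟨u', huu', h'⟩ := hZ.forth ((hbit hw hu).mp h) hwv
    exact ⟨u', huu', hwv.2.1, huu'.2.1, (hbit hwv.2.1 huu'.2.1).mpr h'⟩
  · rintro w u u' ⟨hw, hu, h⟩ huu'
    obtain ⟨v, hwv, h'⟩ := hZ.back ((hbit hw hu).mp h) huu'
    exact ⟨v, hwv, hwv.2.1, huu'.2.1, (hbit hwv.2.1 huu'.2.1).mpr h'⟩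

theorem isSplitting_add_iff (φ : Formula) : IsSplitting (add K φ) ↔ CodesSplitting φ.code :=
  ⟨codesSplitting_of_isSplitting, isSplitting_of_codesSplitting⟩

end NormalLogic

/-! ### The criterion is primitive recursive -/

namespace PrimrecPred

variable {α : Type} [Primcodable α]

protected theorem imp {p q : α → Prop} (hp : PrimrecPred p) (hq : PrimrecPred q) :
    PrimrecPred fun a => p a → q a :=
  (hp.not.or hq).of_eq fun _ => imp_iff_not_or.symm

protected theorem iff {p q : α → Prop} (hp : PrimrecPred p) (hq : PrimrecPred q) :
    PrimrecPred fun a => (p a ↔ q a) :=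
  ((hp.imp hq).and (hq.imp hp)).of_eq fun _ => iff_def.symm

theorem forall_lt_of {p : α × ℕ → Prop} {b : α → ℕ} (hb : Primrec b)
    (hp : PrimrecPred p) : PrimrecPred fun a => ∀ n < b a, p (a, n) :=
  ((PrimrecRel.forall_mem_list (R := fun n a => p (a, n))
    (hp.comp (Primrec.snd.pair Primrec.fst))).comp (Primrec.list_range.comp hb) Primrec.id).of_eq
    fun _ => by simp

theorem exists_lt_of {p : α × ℕ → Prop} {b : α → ℕ} (hb : Primrec b)
    (hp : PrimrecPred p) : PrimrecPred fun a => ∃ n < b a, p (a, n) :=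
  ((PrimrecRel.exists_mem_list (R := fun n a => p (a, n))
    (hp.comp (Primrec.snd.pair Primrec.fst))).comp (Primrec.list_range.comp hb) Primrec.id).of_eq
    fun _ => by simp

end PrimrecPred

theorem primrec_pow : Primrec₂ ((· ^ ·) : ℕ → ℕ → ℕ) :=
  Primrec₂.unpaired'.mp Nat.Primrec.pow

theorem primrecRel_bit : PrimrecRel Bit :=
  (Primrec.eq.comp (Primrec.nat_mod.comp (Primrec.nat_div.comp Primrec.fst
    (primrec_pow.comp (Primrec.const 2) Primrec.snd)) (Primrec.const 2))
    (Primrec.const 1) : PrimrecPred fun q : ℕ × ℕ => q.1 / 2 ^ q.2 % 2 = 1).of_eq fun q => by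
      simp [Bit, Nat.testBit_eq_decide_div_mod_eq]

section

variable {α : Type} [Primcodable α] {D N D' N' Z t b c i w u : α → ℕ}

/-- A digit position is smaller than the number, so the quantifier is bounded by `D a`. -/
theorem primrecPred_forall_bit {p : α × ℕ → Prop} (hD : Primrec D)
    (hp : PrimrecPred p) :
    PrimrecPred fun a => ∀ w, Bit (D a) w → p (a, w) :=
  (PrimrecPred.forall_lt_of hD
    ((primrecRel_bit.comp (hD.comp Primrec.fst) Primrec.snd).imp hp)).of_eq fun _ =>
    ⟨fun h w hw => h w hw.lt hw, fun h w _ hw => h w hw⟩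

theorem primrecPred_exists_bit {p : α × ℕ → Prop} (hD : Primrec D)
    (hp : PrimrecPred p) :
    PrimrecPred fun a => ∃ w, Bit (D a) w ∧ p (a, w) :=
  (PrimrecPred.exists_lt_of hD
    ((primrecRel_bit.comp (hD.comp Primrec.fst) Primrec.snd).and hp)).of_eq fun _ =>
    ⟨fun ⟨w, _, h⟩ => ⟨w, h⟩, fun ⟨w, h⟩ => ⟨w, h.1.lt, h⟩⟩

theorem primrecPred_bit_pair (ht : Primrec t) (hi : Primrec i) (hw : Primrec w) :
    PrimrecPred fun a => Bit (t a) (Nat.pair (i a) (w a)) :=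
  primrecRel_bit.comp ht (Primrec₂.natPair.comp hi hw)

theorem primrecPred_codedRel (hD : Primrec D) (hN : Primrec N) (hw : Primrec w)
    (hu : Primrec u) : PrimrecPred fun a => CodedRel (D a) (N a) (w a) (u a) :=
  (primrecRel_bit.comp hD hw).and ((primrecRel_bit.comp hD hu).and
    (primrecPred_bit_pair hN hw hu))

theorem primrec_mul_three_add (hi : Primrec i) (n : ℕ) : Primrec fun a => 3 * i a + n :=
  Primrec.nat_add.comp (Primrec.nat_mul.comp (.const 3) hi) (.const n)

theorem primrecPred_isTruthTable (hc : Primrec c) (hD : Primrec D) (hN : Primrec N)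
    (ht : Primrec t) : PrimrecPred fun a => IsTruthTable (c a) (D a) (N a) (t a) := by
  have hc1 := hc.comp (Primrec.fst (α := α) (β := ℕ))
  have ht1 := ht.comp (Primrec.fst (α := α) (β := ℕ))
  have hc2 := hc1.comp (Primrec.fst (α := α × ℕ) (β := ℕ))
  have ht2 := ht1.comp (Primrec.fst (α := α × ℕ) (β := ℕ))
  have hD2 := (hD.comp (Primrec.fst (α := α) (β := ℕ))).comp (Primrec.fst (α := α × ℕ) (β := ℕ))
  have hN2 := (hN.comp (Primrec.fst (α := α) (β := ℕ))).comp (Primrec.fst (α := α × ℕ) (β := ℕ))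
  have hw2 := (Primrec.snd (α := α) (β := ℕ)).comp (Primrec.fst (α := α × ℕ) (β := ℕ))
  have hm2 := Primrec.snd (α := α × ℕ) (β := ℕ)
  -- The two subformula codes are quantified as one paired number, bounded by `c`.
  have himp := PrimrecPred.forall_lt_of hc1 <|
    (Primrec.nat_le.comp (primrec_mul_three_add hm2 2) hc2).imp <|
    (primrecPred_bit_pair ht2 (primrec_mul_three_add hm2 2) hw2).iff <|
    (primrecPred_bit_pair ht2 (Primrec.fst.comp (Primrec.unpair.comp hm2)) hw2).imp <|
    primrecPred_bit_pair ht2 (Primrec.snd.comp (Primrec.unpair.comp hm2)) hw2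
  have hbox := PrimrecPred.forall_lt_of hc1 <|
    (Primrec.nat_le.comp (primrec_mul_three_add hm2 3) hc2).imp <|
    (primrecPred_bit_pair ht2 (primrec_mul_three_add hm2 3) hw2).iff <|
    primrecPred_forall_bit hD2 <|
    (primrecPred_codedRel (hD2.comp .fst) (hN2.comp .fst) (hw2.comp .fst) .snd).imp <|
    primrecPred_bit_pair (ht2.comp .fst) (hm2.comp .fst) .snd
  refine (primrecPred_forall_bit hD <|
    (primrecPred_bit_pair ht1 (.const 0) .snd).not.and (himp.and hbox)).of_eq fun a => ?_
  refine forall₂_congr fun w hw => and_congr_right fun _ => and_congr ?_ ?_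
  · constructor
    · intro h i j hij
      have := h (Nat.pair i j) (show _ < c a by omega) hij
      rwa [Nat.unpair_pair] at this
    · intro h m _ hm
      have := h m.unpair.1 m.unpair.2
      rw [Nat.pair_unpair] at this
      exact this hm
  · constructor
    · exact fun h i hi => (h i (show _ < c a by omega) hi).trans
        ⟨fun h u hu => h u hu.2.1 hu, fun h u _ hu => h u hu⟩
    · exact fun h i _ hi => (h i hi).trans
        ⟨fun h u _ hu => h u hu, fun h u hu => h u hu.2.1 hu⟩

theorem primrecPred_refutes (hb : Primrec b) (hc : Primrec c) (hD : Primrec D)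
    (hN : Primrec N) : PrimrecPred fun a => Refutes (b a) (c a) (D a) (N a) :=
  PrimrecPred.exists_lt_of hb <|
    (primrecPred_isTruthTable (hc.comp .fst) (hD.comp .fst) (hN.comp .fst) .snd).and <|
    primrecPred_exists_bit (hD.comp .fst) <|
    (primrecPred_bit_pair (Primrec.snd.comp .fst) ((hc.comp .fst).comp .fst) .snd).not

theorem primrecPred_codesFunBisim (hD : Primrec D) (hN : Primrec N) (hD' : Primrec D')
    (hN' : Primrec N') (hZ : Primrec Z) :
    PrimrecPred fun a => CodesFunBisim (D a) (N a) (D' a) (N' a) (Z a) := by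
  have h2 := (Primrec.fst (α := α) (β := ℕ)).comp (Primrec.fst (α := α × ℕ) (β := ℕ))
  have h3 := h2.comp (Primrec.fst (α := (α × ℕ) × ℕ) (β := ℕ))
  have h4 := h3.comp (Primrec.fst (α := ((α × ℕ) × ℕ) × ℕ) (β := ℕ))
  have hw2 := (Primrec.snd (α := α) (β := ℕ)).comp (Primrec.fst (α := α × ℕ) (β := ℕ))
  have hw3 := hw2.comp (Primrec.fst (α := (α × ℕ) × ℕ) (β := ℕ))
  have hw4 := hw3.comp (Primrec.fst (α := ((α × ℕ) × ℕ) × ℕ) (β := ℕ))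
  have hs2 := Primrec.snd (α := α × ℕ) (β := ℕ)
  have hs3 := hs2.comp (Primrec.fst (α := (α × ℕ) × ℕ) (β := ℕ))
  have hs4 := hs3.comp (Primrec.fst (α := ((α × ℕ) × ℕ) × ℕ) (β := ℕ))
  have hu3 := Primrec.snd (α := (α × ℕ) × ℕ) (β := ℕ)
  have hu4 := hu3.comp (Primrec.fst (α := ((α × ℕ) × ℕ) × ℕ) (β := ℕ))
  have hv4 := Primrec.snd (α := ((α × ℕ) × ℕ) × ℕ) (β := ℕ)
  have hfun := primrecPred_forall_bit (hD'.comp h2) <|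
    (primrecPred_bit_pair (hZ.comp h3) hw3 hu3).imp (Primrec.eq.comp hs3 hu3)
  have hforth := primrecPred_forall_bit (hD.comp h2) <|
    (primrecPred_codedRel (hD.comp h3) (hN.comp h3) hw3 hu3).imp <|
    primrecPred_exists_bit (hD'.comp h3) <|
    (primrecPred_codedRel (hD'.comp h4) (hN'.comp h4) hs4 hv4).and <|
    primrecPred_bit_pair (hZ.comp h4) hu4 hv4
  have hback := primrecPred_forall_bit (hD'.comp h2) <|
    (primrecPred_codedRel (hD'.comp h3) (hN'.comp h3) hs3 hu3).imp <|
    primrecPred_exists_bit (hD.comp h3) <|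
    (primrecPred_codedRel (hD.comp h4) (hN.comp h4) hw4 hv4).and <|
    primrecPred_bit_pair (hZ.comp h4) hv4 hu4
  refine (primrecPred_forall_bit hD <| primrecPred_forall_bit (hD'.comp .fst) <|
    (primrecPred_bit_pair (hZ.comp h2) hw2 hs2).imp <|
    hfun.and (hforth.and hback)).of_eq fun a => ⟨fun h => ⟨?_, ?_, ?_⟩, fun h => ?_⟩
  · rintro w s s' ⟨hw, hs, hws⟩ ⟨-, hs', hws'⟩
    exact (h w hw s hs hws).1 s' hs' hws'
  · rintro w s u ⟨hw, hs, hws⟩ hwu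
    obtain ⟨s', hs', hss', hus'⟩ := (h w hw s hs hws).2.1 u hwu.2.1 hwu
    exact ⟨s', hss', hwu.2.1, hs', hus'⟩
  · rintro w s s' ⟨hw, hs, hws⟩ hss'
    obtain ⟨u, hu, hwu, hus'⟩ := (h w hw s hs hws).2.2 s' hss'.2.1 hss'
    exact ⟨u, hwu, hu, hss'.2.1, hus'⟩
  · intro w hw s hs hws
    refine ⟨fun s' hs' hws' => h.functional ⟨hw, hs, hws⟩ ⟨hw, hs', hws'⟩,
      fun u _ hwu => ?_, fun s' _ hss' => ?_⟩
    · obtain ⟨s', hss', -, hs', hus'⟩ := h.forth ⟨hw, hs, hws⟩ hwu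
      exact ⟨s', hs', hss', hus'⟩
    · obtain ⟨u, hwu, hu, -, hus'⟩ := h.back ⟨hw, hs, hws⟩ hss'
      exact ⟨u, hu, hwu, hus'⟩

end

theorem primrec_typeBound : Primrec₂ Formula.typeBound := by
  have hpow : Primrec fun c : ℕ => 2 ^ c := primrec_pow.comp (.const 2) .id
  have hstep : Primrec₂ fun (c : ℕ) (q : ℕ × ℕ) => (2 ^ c + 2 ^ q.2) ^ 2 :=
    primrec_pow.comp (Primrec.nat_add.comp (hpow.comp .fst)
      (hpow.comp (Primrec.snd.comp .snd))) (.const 2)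
  refine (Primrec.nat_rec (primrec_pow.comp hpow (.const 2)) hstep).of_eq fun c k => ?_
  induction k with
  | zero => rfl
  | succ k ih => exact congrArg (fun n => (2 ^ c + 2 ^ n) ^ 2) ih

theorem primrec_codeBound : Primrec₂ codeBound :=
  primrec_pow.comp (.const 2) (primrec_pow.comp (Primrec.succ.comp Primrec.nat_add) (.const 2))

theorem primrec_frameBound : Primrec frameBound :=
  primrec_codeBound.comp .id (primrec_typeBound.comp .id .succ)

theorem primrec_testBound : Primrec testBound :=
  primrec_codeBound.comp .id (primrec_typeBound.comp .id
    (Primrec.nat_add.comp primrec_frameBound .id))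

theorem primrecPred_codesSplitting : PrimrecPred CodesSplitting := by
  have hc2 := (Primrec.fst (α := ℕ) (β := ℕ)).comp (Primrec.fst (α := ℕ × ℕ) (β := ℕ))
  have hD2 := (Primrec.snd (α := ℕ) (β := ℕ)).comp (Primrec.fst (α := ℕ × ℕ) (β := ℕ))
  have hN2 := Primrec.snd (α := ℕ × ℕ) (β := ℕ)
  have h4 := (Primrec.fst (α := (ℕ × ℕ) × ℕ) (β := ℕ)).comp
    (Primrec.fst (α := ((ℕ × ℕ) × ℕ) × ℕ) (β := ℕ))
  have h6 := (h4.comp (Primrec.fst (α := (((ℕ × ℕ) × ℕ) × ℕ) × ℕ) (β := ℕ))).comp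
    (Primrec.fst (α := ((((ℕ × ℕ) × ℕ) × ℕ) × ℕ) × ℕ) (β := ℕ))
  have hacyclic : PrimrecPred fun q : (ℕ × ℕ) × ℕ =>
      ∀ w u, CodedRel q.1.2 q.2 w u → u < w :=
    (primrecPred_forall_bit hD2 <| primrecPred_forall_bit (hD2.comp .fst) <|
      (primrecPred_codedRel ((hD2.comp .fst).comp .fst) ((hN2.comp .fst).comp .fst)
        (Primrec.snd.comp .fst) .snd).imp
        (Primrec.nat_lt.comp .snd (Primrec.snd.comp .fst))).of_eq fun q =>
      ⟨fun h w u hwu => h w hwu.1 u hwu.2.1 hwu, fun h w _ u _ hwu => h w u hwu⟩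
  have hhit := primrecPred_exists_bit (Primrec.snd.comp (Primrec.fst.comp (Primrec.fst.comp
      (Primrec.fst (α := ((((ℕ × ℕ) × ℕ) × ℕ) × ℕ) × ℕ) (β := ℕ))))) <|
    primrecPred_bit_pair (Primrec.snd.comp .fst) .snd ((Primrec.snd.comp .fst).comp .fst)
  have h := PrimrecPred.exists_lt_of primrec_frameBound <|
    PrimrecPred.exists_lt_of (primrec_frameBound.comp .fst) <| hacyclic.and <|
    (primrecPred_refutes (primrec_frameBound.comp hc2) hc2 hD2 hN2).and <|
    PrimrecPred.forall_lt_of (primrec_testBound.comp hc2) <|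
    PrimrecPred.forall_lt_of ((primrec_testBound.comp hc2).comp .fst) <|
    (primrecPred_refutes (primrec_testBound.comp (hc2.comp h4)) (hc2.comp h4)
      (Primrec.snd.comp .fst) .snd).imp <|
    primrecPred_forall_bit (hD2.comp h4) <|
    PrimrecPred.exists_lt_of (primrec_codeBound.comp
      (primrec_testBound.comp ((hc2.comp h4).comp .fst))
      (primrec_frameBound.comp ((hc2.comp h4).comp .fst))) <|
    hhit.and <|
    primrecPred_codesFunBisim (((Primrec.snd.comp .fst).comp .fst).comp .fst)
      ((Primrec.snd.comp .fst).comp .fst) (hD2.comp h6) (hN2.comp h6) .snd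
  exact h

theorem primrec_code : Primrec Formula.code :=
  Primrec.of_equiv (e := Formula.codeEquiv)

theorem mainTheorem3 :
    NormalLogic.DecidableIn NormalLogic.K
      (fun L : NormalLogic.NExt NormalLogic.K => IsSplitting L) := by
  exact ((primrecPred_codesSplitting.comp primrec_code).of_eq fun φ =>
    (NormalLogic.isSplitting_add_iff φ).symm).computablePred
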